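/- Let $q$ be a prime power and let $n,m$ be integers with $2\le n\le m\le q$. Let $\alpha$ be a primitive element of $\mathbb F_{q^m}$ over $\mathbb F_q$ (that is, $\mathbb F_q(\alpha)=\mathbb F_{q^m}$) and let $U=\langle 1,\alpha,\dots,\alpha^{n-1}\rangle_{\mathbb F_q}$. Let $\mathcal G_{1,1}(0)=\{f_0x : f_0\in\mathbb F_{q^m}\}$. Fix an $\mathbb F_q$-basis $\gamma=(\gamma_1,\dots,\gamma_n)$ of $U$ and an $\mathbb F_q$-basis $\Gamma$ of $\mathbb F_{q^m}$, and regard the Delsarte–Gabidulin code $\pi_U(\mathcal G_{1,1}(0))$ as the matrix code in $\mathbb F_q^{n\times m}$ consisting of the matrices whose $i$-th row is the coordinate vector of $f(\gamma_i)$ with respect to $\Gamma$, for $f\in\mathcal G_{1,1}(0)$. Let $$\mathcal C=\pi_U(\mathcal G_{1,1}(0))^\perp=\{N\in\mathbb F_q^{n\times m} : \operatorname{Tr}(MN^t)=0\text{ for all }M\in\pi_U(\mathcal G_{1,1}(0))\}.$$ The tensor rank $\operatorname{trk}(\mathcal D)$ of a $k$-dimensional subspace $\mathcal D\le\mathbb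 F_q^{n\times m}$ is the least $R$ such that a tensor $X\in\mathbb F_q^{k\times n\times m}$ whose $k$ slices $X_1,\dots,X_k\in\mathbb F_q^{n\times m}$ span $\mathcal D$ is a sum of $R$ simple tensors $u\otimes v\otimes w$ (this does not depend on the choice of $X$). Then, for every choice of the bases $\gamma$ and $\Gamma$, $\operatorname{trk}(\mathcal C)=mn-m+1$. Moreover $\mathcal C$ is MTR (minimal tensor rank), i.e. it meets Kruskal's tensor-rank bound with equality: $\operatorname{trk}(\mathcal C)=\dim_{\mathbb F_q}(\mathcal C)+d(\mathcal C)-1$, where $d(\mathcal C)$ is the least rank of a nonzero matrix in $\mathcal C$. -/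

import Mathlib

open Polynomial

/-- Coordinate 3-tensors `X = (X_1 | ⋯ | X_k)` in `K^{k × n × m}`, given by their
`k` slices, which are `n × m` matrices. -/
abbrev Tensor3 (K : Type*) (k n m : ℕ) := Fin k → Matrix (Fin n) (Fin m) K

namespace Tensor3

variable {K : Type*} [Field K] {k n m : ℕ}

/-- The simple tensor `u ⊗ v ⊗ w`. -/
def simple (u : Fin k → K) (v : Fin n → K) (w : Fin m → K) : Tensor3 K k n m :=
  fun l => Matrix.of fun i j => u l * v i * w j

/-- `X` is a sum of `R` simple tensors. -/
def IsSumOfSimple (X : Tensor3 K k n m) (R : ℕ) : Prop :=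
  ∃ (u : Fin R → Fin k → K) (v : Fin R → Fin n → K) (w : Fin R → Fin m → K),
    X = ∑ r, simple (u r) (v r) (w r)

/-- The tensor rank of a 3-tensor: the least `R` such that it is a sum of `R` simple tensors. -/
noncomputable def trk (X : Tensor3 K k n m) : ℕ := sInf {R | X.IsSumOfSimple R}

/-- The first slice space: the span of the slices. -/
def sliceSpace (X : Tensor3 K k n m) : Submodule K (Matrix (Fin n) (Fin m) K) :=
  Submodule.span K (Set.range X)

/-- `X` is a generator tensor of `V`: it has `dim V` slices, and they span `V`. -/
def IsGenerator (X : Tensor3 K k n m) (V : Submodule K (Matrix (Fin n) (Fin m) K)) : Prop :=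
  k = Module.finrank K V ∧ X.sliceSpace = V

/-- Every tensor is a sum of finitely many simple tensors, so `trk` is a genuine minimum. -/
theorem exists_isSumOfSimple (X : Tensor3 K k n m) : ∃ R, X.IsSumOfSimple R := by
  let e := Fintype.equivFin (Fin k × Fin n × Fin m)
  refine ⟨_, fun r => Pi.single (e.symm r).1 (X (e.symm r).1 (e.symm r).2.1 (e.symm r).2.2),
    fun r => Pi.single (e.symm r).2.1 1, fun r => Pi.single (e.symm r).2.2 1, ?_⟩
  rw [e.symm.sum_comp (fun p : Fin k × Fin n × Fin m =>
    simple (Pi.single p.1 (X p.1 p.2.1 p.2.2)) (Pi.single p.2.1 1) (Pi.single p.2.2 1))]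
  ext l i j
  simp [Finset.sum_apply, Matrix.sum_apply, simple, Fintype.sum_prod_type, Pi.single_apply]

theorem isSumOfSimple_trk (X : Tensor3 K k n m) : X.IsSumOfSimple X.trk :=
  Nat.sInf_mem X.exists_isSumOfSimple

theorem trk_le_of_sliceSpace_le {k' : ℕ} (X : Tensor3 K k n m) (Y : Tensor3 K k' n m)
    (h : X.sliceSpace ≤ Y.sliceSpace) : X.trk ≤ Y.trk := by
  obtain ⟨u, v, w, hY⟩ := Y.isSumOfSimple_trk
  have hc : ∀ l, ∃ c : Fin k' → K, ∑ a, c a • Y a = X l := fun l =>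
    (Submodule.mem_span_range_iff_exists_fun K).1
      (h (Submodule.subset_span (Set.mem_range_self l)))
  choose c hc using hc
  refine Nat.sInf_le ⟨fun r l => ∑ a, c l a * u r a, v, w, ?_⟩
  ext l i j
  have hYa : ∀ a, Y a i j = ∑ r, u r a * v r i * w r j := fun a => by
    have := congrFun (congrFun (congrFun hY a) i) j
    simpa [Finset.sum_apply, Matrix.sum_apply, simple] using this
  rw [← hc l]
  simp only [Matrix.sum_apply, Matrix.smul_apply, smul_eq_mul, hYa, Finset.sum_apply, simple,
    Matrix.of_apply, Finset.mul_sum, Finset.sum_mul]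
  rw [Finset.sum_comm]
  refine Finset.sum_congr rfl fun r _ => Finset.sum_congr rfl fun a _ => by ring

end Tensor3

namespace MatrixCode

variable {K : Type*} [Field K] {n m : ℕ}

/-- A generator tensor of `V`, whose slices are a basis of `V`. -/
noncomputable def generator (V : Submodule K (Matrix (Fin n) (Fin m) K)) :
    Tensor3 K (Module.finrank K V) n m :=
  fun l => (Module.finBasis K V l : Matrix (Fin n) (Fin m) K)

theorem isGenerator_generator (V : Submodule K (Matrix (Fin n) (Fin m) K)) :
    (generator V).IsGenerator V := by
  refine ⟨rfl, ?_⟩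
  have h := congrArg (Submodule.map V.subtype) (Module.finBasis K V).span_eq
  rw [Submodule.map_span, ← Set.range_comp, Submodule.map_top, Submodule.range_subtype] at h
  exact h

/-- The tensor rank of a space of matrices: the tensor rank of a generator tensor. By
`MatrixCode.trk_eq` below it does not depend on the generator tensor. -/
noncomputable def trk (V : Submodule K (Matrix (Fin n) (Fin m) K)) : ℕ :=
  (generator V).trk

theorem trk_eq {k : ℕ} (V : Submodule K (Matrix (Fin n) (Fin m) K)) (X : Tensor3 K k n m)
    (hX : X.IsGenerator V) : X.trk = trk V :=
  le_antisymm
    (X.trk_le_of_sliceSpace_le _ (hX.2.trans (isGenerator_generator V).2.symm).le)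
    (Tensor3.trk_le_of_sliceSpace_le _ X ((isGenerator_generator V).2.trans hX.2.symm).le)

/-- The dual with respect to the trace bilinear form `(M, N) ↦ Tr (M Nᵗ)`. -/
def dual (V : Submodule K (Matrix (Fin n) (Fin m) K)) :
    Submodule K (Matrix (Fin n) (Fin m) K) where
  carrier := {N | ∀ M ∈ V, (M * N.transpose).trace = 0}
  zero_mem' := by
    intro M _
    simp
  add_mem' := by
    intro A B hA hB M hM
    simp [Matrix.mul_add, hA M hM, hB M hM]
  smul_mem' := by
    intro c A hA M hM
    simp [hA M hM]

open Classical in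
/-- The minimum rank distance: the least rank of a nonzero codeword, and `n + 1` for the
zero code. -/
noncomputable def minDist (C : Submodule K (Matrix (Fin n) (Fin m) K)) : ℕ :=
  if C = ⊥ then n + 1 else sInf {d | ∃ X ∈ C, X ≠ 0 ∧ X.rank = d}

/-- Minimal tensor rank: equality in the tensor-rank bound `trk C ≥ dim C + d(C) - 1`. -/
def IsMTR (C : Submodule K (Matrix (Fin n) (Fin m) K)) : Prop :=
  (trk C : ℤ) = Module.finrank K C + minDist C - 1

end MatrixCode

namespace Gabidulin

variable (F : Type*) {L : Type*} [Field F] [Field L] [Algebra F L] {n m : ℕ}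

/-- `𝒢_{k,s}(η)`: the linearized polynomials
`∑_{i < k} f_i x^{q^{s i}} + η f_0 x^{q^{s k}}` with `f_0, …, f_{k-1} ∈ L` and `q = |F|`. -/
noncomputable def polys (k s : ℕ) (η : L) : Submodule L L[X] where
  carrier := {p | ∃ f : ℕ → L,
    p = ∑ i ∈ Finset.range k, C (f i) * X ^ (Nat.card F ^ (s * i))
      + C (η * f 0) * X ^ (Nat.card F ^ (s * k))}
  zero_mem' := ⟨0, by simp⟩
  add_mem' := by
    rintro _ _ ⟨f, rfl⟩ ⟨g, rfl⟩
    refine ⟨f + g, ?_⟩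
    simp only [Pi.add_apply, C_add, mul_add, add_mul, Finset.sum_add_distrib]
    ring
  smul_mem' := by
    rintro c _ ⟨f, rfl⟩
    refine ⟨fun i => c * f i, ?_⟩
    simp only [smul_eq_C_mul, C_mul, mul_add, Finset.mul_sum]
    congr 1
    · exact Finset.sum_congr rfl fun i _ => by ring
    · ring

variable {F}

/-- The evaluation map `π_β : f ↦ Γ(f(β_1), …, f(β_n))`, where `Γ` expands each entry of a
vector in `L^n` as a row of coordinates in the `F`-basis `Γ` of `L`. -/
noncomputable def evalMap (Γ : Module.Basis (Fin m) F L) (β : Fin n → L) :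
    L[X] →ₗ[F] Matrix (Fin n) (Fin m) F where
  toFun f := Matrix.of fun i j => Γ.repr (f.eval (β i)) j
  map_add' f g := by
    ext i j
    simp
  map_smul' c f := by
    ext i j
    simp

/-- The code `π_U(𝒢_{k,s}(η))` as a matrix code in `F^{n × m}`. The class of `f` modulo the
polynomials vanishing on the `n`-dimensional space `U` is represented by the matrix `π_γ(f)`,
where `γ` is an `F`-basis of `U`, and `Γ` is an `F`-basis of `L`. -/
noncomputable def code (Γ : Module.Basis (Fin m) F L) {U : Submodule F L}
    (γ : Module.Basis (Fin n) F U) (k s : ℕ) (η : L) :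
    Submodule F (Matrix (Fin n) (Fin m) F) :=
  ((polys F k s η).restrictScalars F).map (evalMap Γ fun i => (γ i : L))

variable (F)

/-- `U = ⟨1, α, …, α^{n-1}⟩_F`. -/
def powerSpan (n : ℕ) (α : L) : Submodule F L :=
  Submodule.span F (Set.range fun i : Fin n => α ^ (i : ℕ))

end Gabidulin

/-!
Fix a nonzero functional `l : L → F` and let `δ` be the basis dual to `Γ` for
`(x, y) ↦ l (x * y)`. Then `Tr (M Nᵗ) = l (f₀ * ∑ i, ∑ j, N i j • (γ i * δ j))` for the codeword `M`
of `f₀ x`, so the dual code is the kernel of the multiplication map `U ⊗ L → L`, of dimension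
`n m - m`. A matrix of rank one is a pure tensor, and a field has no zero divisors, so the distance
is at least two and Kruskal's bound gives tensor rank at least `n m - m + 1`.

Conversely, choose distinct `t₁, …, tₘ` in `F`. The kernel lies in the span of the `(n - 1) m + 1`
pure tensors `u ⊗ u⁻¹` with `u = 1` or `u = α ^ i * (α - tₖ)`, `i < n - 1`. Indeed, modulo this span
`(a * α) ⊗ z = a ⊗ (α * z)` for `a = α ^ i` and every `z`: by partial fractions `L` is spanned by
the elements `z = (a * (α - tₖ))⁻¹`, and for these both sides equal `tₖ • (a ⊗ z)`, because
`a ⊗ a⁻¹ = 1 ⊗ 1 = 0` by induction on `i`. Hence `u ⊗ x` becomes `1 ⊗ u * x` for all `u` in `U`, and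
a tensor in the kernel becomes `0`.
-/

namespace MatrixCode

variable {K : Type*} [Field K] {n m : ℕ}

theorem trk_le_card_of_le_span {ι : Type*} [Fintype ι]
    {V : Submodule K (Matrix (Fin n) (Fin m) K)} {v : ι → Fin n → K} {w : ι → Fin m → K}
    (hV : V ≤ Submodule.span K (Set.range fun r => Matrix.vecMulVec (v r) (w r))) :
    trk V ≤ Fintype.card ι := by
  have hcoeff : ∀ l, ∃ c : ι → K, ∑ r, c r • Matrix.vecMulVec (v r) (w r) = generator V l :=
    fun l => (Submodule.mem_span_range_iff_exists_fun K).1 (hV (Module.finBasis K V l).2)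
  choose c hc using hcoeff
  let e := (Fintype.equivFin ι).symm
  refine Nat.sInf_le ⟨fun r l => c l (e r), fun r => v (e r), fun r => w (e r), ?_⟩
  ext l i j
  rw [← hc l, ← e.sum_comp]
  simp [Matrix.sum_apply, Tensor3.simple, Matrix.vecMulVec_apply, mul_assoc]

theorem exists_le_span_vecMulVec (V : Submodule K (Matrix (Fin n) (Fin m) K)) :
    ∃ (v : Fin (trk V) → Fin n → K) (w : Fin (trk V) → Fin m → K),
      V ≤ Submodule.span K (Set.range fun r => Matrix.vecMulVec (v r) (w r)) := by
  obtain ⟨u, v, w, huvw⟩ := (generator V).isSumOfSimple_trk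
  refine ⟨v, w, (isGenerator_generator V).2.symm.trans_le (Submodule.span_le.2 ?_)⟩
  rintro _ ⟨l, rfl⟩
  refine (Submodule.mem_span_range_iff_exists_fun K).2 ⟨fun r => u r l, ?_⟩
  rw [huvw]
  ext i j
  simp only [Matrix.sum_apply, Finset.sum_apply, Tensor3.simple, Matrix.vecMulVec_apply,
    Matrix.smul_apply, Matrix.of_apply, smul_eq_mul, mul_assoc]
  rfl

theorem rank_le_card_of_mem_span_vecMulVec {ι : Type*} {s : Finset ι}
    {v : ι → Fin n → K} {w : ι → Fin m → K} {N : Matrix (Fin n) (Fin m) K}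
    (hN : N ∈ Submodule.span K ((fun r => Matrix.vecMulVec (v r) (w r)) '' s)) :
    N.rank ≤ s.card := by
  rw [Set.image_eq_range] at hN
  obtain ⟨c, rfl⟩ := (Submodule.mem_span_range_iff_exists_fun K).1 hN
  have hfactor : ∑ r : s, c r • Matrix.vecMulVec (v r) (w r) =
      (Matrix.of fun i (r : s) => c r * v r i) * Matrix.of fun (r : s) j => w r j := by
    ext i j
    simp [Matrix.sum_apply, Matrix.mul_apply, Matrix.vecMulVec_apply, mul_assoc]
  calc _ = _ := congrArg Matrix.rank hfactor
    _ ≤ _ := Matrix.rank_mul_le_left _ _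
    _ ≤ s.card := (Matrix.rank_le_card_width _).trans_eq (Fintype.card_coe s)

theorem exists_eq_vecMulVec_of_rank_le_one {N : Matrix (Fin n) (Fin m) K} (hN : N.rank ≤ 1) :
    ∃ v w, N = Matrix.vecMulVec v w := by
  obtain ⟨v, hv⟩ := finrank_le_one_iff.1 hN
  choose w hw using fun j => hv ⟨_, LinearMap.mem_range_self N.mulVecLin (Pi.single j 1)⟩
  refine ⟨v, w, Matrix.ext fun i j => ?_⟩
  have hentry := congrFun (congrArg Subtype.val (hw j)) i
  simp only [Submodule.coe_smul, Pi.smul_apply, smul_eq_mul, Matrix.mulVecLin_apply,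
    Matrix.mulVec_single_one, Matrix.col_apply] at hentry
  rw [Matrix.vecMulVec_apply, ← hentry, mul_comm]

theorem minDist_le_rank {V : Submodule K (Matrix (Fin n) (Fin m) K)}
    {N : Matrix (Fin n) (Fin m) K} (hN : N ∈ V) (hN₀ : N ≠ 0) : minDist V ≤ N.rank := by
  rw [minDist, if_neg (Submodule.ne_bot_iff V |>.2 ⟨N, hN, hN₀⟩)]
  exact Nat.sInf_le ⟨N, hN, hN₀, rfl⟩

theorem le_minDist {V : Submodule K (Matrix (Fin n) (Fin m) K)} {d : ℕ} (hV : V ≠ ⊥)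
    (hd : ∀ N ∈ V, N ≠ 0 → d ≤ N.rank) : d ≤ minDist V := by
  rw [minDist, if_neg hV]
  obtain ⟨N, hN, hN₀⟩ := (Submodule.ne_bot_iff V).1 hV
  refine le_csInf ⟨_, N, hN, hN₀, rfl⟩ ?_
  rintro _ ⟨M, hM, hM₀, rfl⟩
  exact hd M hM hM₀

theorem exists_mem_ne_zero_rank_le_card_compl {ι : Type*} [Fintype ι] [DecidableEq ι]
    {V : Submodule K (Matrix (Fin n) (Fin m) K)} {v : ι → Fin n → K} {w : ι → Fin m → K}
    (hV : V ≤ Submodule.span K (Set.range fun r => Matrix.vecMulVec (v r) (w r)))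
    {s : Finset ι} (hs : s.card < Module.finrank K V) :
    ∃ N ∈ V, N ≠ 0 ∧ N.rank ≤ sᶜ.card := by
  classical
  let f : ι → Matrix (Fin n) (Fin m) K := fun r => Matrix.vecMulVec (v r) (w r)
  let S := Submodule.span K (f '' s)
  let T := Submodule.span K (f '' (sᶜ : Finset ι))
  have hST : V ⊔ T ≤ S ⊔ T := by
    refine sup_le (hV.trans ?_) le_sup_right
    rw [← Submodule.span_union, ← Set.image_union, Finset.coe_compl, Set.union_compl_self,
      Set.image_univ]
  have hS : Module.finrank K S ≤ s.card := by
    have h := finrank_span_finset_le_card (R := K) (s.image f)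
    rw [Finset.coe_image] at h
    exact h.trans Finset.card_image_le
  have hdim := Submodule.finrank_sup_add_finrank_inf_eq V T
  have hsup := (Submodule.finrank_mono hST).trans (Submodule.finrank_add_le_finrank_add_finrank S T)
  have hinf : V ⊓ T ≠ ⊥ := Submodule.one_le_finrank_iff.1 (by omega)
  obtain ⟨N, ⟨hNV, hNT⟩, hN₀⟩ := (Submodule.ne_bot_iff _).1 hinf
  exact ⟨N, hNV, hN₀, rank_le_card_of_mem_span_vecMulVec hNT⟩

/-- Kruskal's bound: as in the Singleton bound, prescribing `dim V - 1` zero coefficients leaves a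
nonzero codeword that involves at most `trk V - dim V + 1` matrices of rank one. -/
theorem finrank_add_minDist_le_trk_add_one {V : Submodule K (Matrix (Fin n) (Fin m) K)}
    (hV : V ≠ ⊥) : Module.finrank K V + minDist V ≤ trk V + 1 := by
  obtain ⟨v, w, hle⟩ := exists_le_span_vecMulVec V
  have hpos : 0 < Module.finrank K V := Submodule.one_le_finrank_iff.2 hV
  have hdim : Module.finrank K V ≤ trk V :=
    (Submodule.finrank_mono hle).trans ((finrank_range_le_card _).trans_eq (Fintype.card_fin _))
  obtain ⟨s, -, hs⟩ := Finset.exists_subset_card_eq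
    (s := (Finset.univ : Finset (Fin (trk V)))) (n := Module.finrank K V - 1)
    (by rw [Finset.card_fin]; omega)
  obtain ⟨N, hN, hN₀, hrank⟩ := exists_mem_ne_zero_rank_le_card_compl hle (s := s) (by omega)
  have hd := minDist_le_rank hN hN₀
  rw [Finset.card_compl, Fintype.card_fin] at hrank
  omega

theorem trk_add_one_eq_and_isMTR {V : Submodule K (Matrix (Fin n) (Fin m) K)} {d : ℕ}
    (hV : V ≠ ⊥) (hd : ∀ N ∈ V, N ≠ 0 → d ≤ N.rank)
    (htrk : trk V + 1 ≤ Module.finrank K V + d) :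
    trk V + 1 = Module.finrank K V + d ∧ IsMTR V := by
  have hdist := le_minDist hV hd
  have hkruskal := finrank_add_minDist_le_trk_add_one hV
  unfold IsMTR
  omega

end MatrixCode

namespace Gabidulin

open IntermediateField Module

theorem mem_polys_one_zero_iff {F L : Type*} [Field L] {s : ℕ} {p : L[X]} :
    p ∈ polys F 1 s 0 ↔ ∃ x : L, p = C x * X := by
  constructor
  · rintro ⟨f, rfl⟩
    exact ⟨f 0, by simp⟩
  · rintro ⟨x, rfl⟩
    exact ⟨fun _ => x, by simp⟩

variable {F L : Type*} [Field F] [Field L] [Algebra F L] {n m : ℕ}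

theorem notMem_range_algebraMap_of_adjoin_eq_top {α : L} (hα : F⟮α⟯ = ⊤)
    (hL : finrank F L ≠ 1) : α ∉ Set.range (algebraMap F L) := fun h =>
  hL (bot_eq_top_iff_finrank_eq_one.1 ((adjoin_simple_eq_bot_iff.2 (mem_bot.2 h)).symm.trans hα))

theorem exists_degree_lt_finrank_aeval_eq [FiniteDimensional F L] {α : L} (hα : F⟮α⟯ = ⊤)
    (y : L) : ∃ p : F[X], p.degree < finrank F L ∧ aeval α p = y := by
  have hint : IsIntegral F α := .of_finite F α
  have hadjoin : Algebra.adjoin F {α} = ⊤ := by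
    rw [← adjoin_simple_toSubalgebra_of_isAlgebraic hint.isAlgebraic, hα, top_toSubalgebra]
  let pb := PowerBasis.ofAdjoinEqTop hint hadjoin
  obtain ⟨p, hp, rfl⟩ := pb.exists_eq_aeval y
  rw [pb.finrank]
  exact ⟨p, degree_le_natDegree.trans_lt (by exact_mod_cast hp), rfl⟩

/-- Partial fractions: Lagrange interpolation of `y * ∏ k, (α - t k)` as a polynomial in `α`. -/
theorem span_inv_sub_eq_top [FiniteDimensional F L] {ι : Type*} [Fintype ι] {α : L}
    (hα : F⟮α⟯ = ⊤) {t : ι → F} (ht : Function.Injective t)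
    (hcard : finrank F L ≤ Fintype.card ι) (hne : ∀ k, α ≠ algebraMap F L (t k)) :
    Submodule.span F (Set.range fun k => (α - algebraMap F L (t k))⁻¹) = ⊤ := by
  classical
  refine Submodule.eq_top_iff'.2 fun y => ?_
  let P := eval α (Lagrange.nodal Finset.univ fun k => algebraMap F L (t k))
  have hP : P ≠ 0 := by
    simpa [P, Lagrange.eval_nodal, Finset.prod_ne_zero_iff, sub_ne_zero] using hne
  obtain ⟨p, hdeg, hp⟩ := exists_degree_lt_finrank_aeval_eq hα (P * y)
  have hinterp := Lagrange.eq_interpolate (s := Finset.univ) (f := p.map (algebraMap F L))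
    (v := fun k => algebraMap F L (t k)) ((algebraMap F L).injective.comp ht).injOn
    (by rw [degree_map, Finset.card_univ]; exact hdeg.trans_le (by exact_mod_cast hcard))
  have heval := congrArg (eval α) hinterp
  rw [eval_map_algebraMap, hp, Lagrange.eval_interpolate_not_at_node _ fun k _ => hne k] at heval
  refine (Submodule.mem_span_range_iff_exists_fun F).2
    ⟨fun k => Lagrange.nodalWeight Finset.univ t k * p.eval (t k), ?_⟩
  rw [mul_left_cancel₀ hP heval]
  refine Finset.sum_congr rfl fun k _ => ?_
  have hweight : algebraMap F L (Lagrange.nodalWeight Finset.univ t k) =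
      Lagrange.nodalWeight Finset.univ (fun j => algebraMap F L (t j)) k := by
    simp [Lagrange.nodalWeight]
  rw [Algebra.smul_def, map_mul, hweight, eval_map_apply]
  ring

section BalancedMap

variable {T ι : Type*} [AddCommGroup T] [Module F T] (τ : L →ₗ[F] L →ₗ[F] T)

theorem apply_mul_eq_of_apply_inv_eq_zero {α a : L} (ha : a ≠ 0) {t : ι → F}
    (hne : ∀ k, α ≠ algebraMap F L (t k))
    (hspan : Submodule.span F (Set.range fun k => (α - algebraMap F L (t k))⁻¹) = ⊤)
    (hτa : τ a a⁻¹ = 0)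
    (hτ : ∀ k, τ (a * (α - algebraMap F L (t k))) (a * (α - algebraMap F L (t k)))⁻¹ = 0)
    (x : L) : τ (a * α) x = τ a (α * x) := by
  have hmaps : τ (a * α) ∘ₗ LinearMap.mulLeft F a⁻¹ =
      τ a ∘ₗ LinearMap.mulLeft F α ∘ₗ LinearMap.mulLeft F a⁻¹ := by
    refine LinearMap.ext_on_range hspan fun k => ?_
    have hk := sub_ne_zero.2 (hne k)
    let z := a⁻¹ * (α - algebraMap F L (t k))⁻¹
    have hleft : a * α = a * (α - algebraMap F L (t k)) + t k • a := by
      rw [Algebra.smul_def]; ring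
    have hright : α * z = a⁻¹ + t k • z := by
      simp only [z, Algebra.smul_def]; field_simp; ring
    calc τ (a * α) z = τ (a * (α - algebraMap F L (t k))) z + t k • τ a z := by
          rw [hleft, map_add, map_smul, LinearMap.add_apply, LinearMap.smul_apply]
      _ = τ a a⁻¹ + t k • τ a z := by rw [hτa, ← hτ k, mul_inv]
      _ = τ a (α * z) := by rw [hright, map_add, map_smul]
  simpa [ha] using LinearMap.congr_fun hmaps (a * x)

/-- The elements `1` and `α ^ i * (α - t k)` of `⟨1, α, …, α ^ n⟩`. The matrices of `u ⊗ u⁻¹`, for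
`u` among them, are the terms of an optimal tensor decomposition. -/
def decompositionNode (n : ℕ) (α : L) (t : ι → F) : Option (Fin n × ι) → L
  | none => 1
  | some (i, k) => α ^ (i : ℕ) * (α - algebraMap F L (t k))

theorem apply_eq_apply_one_mul {α : L} (hα : α ∉ Set.range (algebraMap F L)) {t : ι → F}
    (hspan : Submodule.span F (Set.range fun k => (α - algebraMap F L (t k))⁻¹) = ⊤)
    (hτ : ∀ r, τ (decompositionNode n α t r) (decompositionNode n α t r)⁻¹ = 0)
    {u : L} (hu : u ∈ powerSpan F (n + 1) α) (x : L) : τ u x = τ 1 (u * x) := by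
  have hα₀ : α ≠ 0 := fun h => hα ⟨0, by rw [map_zero, h]⟩
  have hone : τ 1 1 = 0 := by simpa [decompositionNode] using hτ none
  have hpow : ∀ i ≤ n, ∀ y, τ (α ^ i) y = τ 1 (α ^ i * y) := by
    intro i hi
    induction i with
    | zero => simp
    | succ i ih =>
      intro y
      have hpow_i := ih (by omega)
      have hinv : τ (α ^ i) (α ^ i)⁻¹ = 0 := by
        rw [hpow_i, mul_inv_cancel₀ (pow_ne_zero i hα₀), hone]
      rw [pow_succ, apply_mul_eq_of_apply_inv_eq_zero τ (pow_ne_zero i hα₀)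
        (fun k h => hα ⟨t k, h.symm⟩) hspan hinv (fun k => hτ (some (⟨i, hi⟩, k))), hpow_i,
        mul_assoc]
  unfold powerSpan at hu
  induction hu using Submodule.span_induction with
  | mem u hu =>
    obtain ⟨i, rfl⟩ := hu
    exact hpow i (Nat.lt_succ_iff.1 i.2) x
  | zero => simp
  | add u v _ _ hu hv => rw [map_add, LinearMap.add_apply, hu, hv, ← map_add, ← add_mul]
  | smul c u _ hu => rw [map_smul, LinearMap.smul_apply, hu, ← map_smul, smul_mul_assoc]

end BalancedMap

variable (F) in
/-- The map `N ↦ ∑ i, ∑ j, N i j • (β i * δ j)`: multiplication `U ⊗ L → L` in coordinates with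
respect to bases `β` of `U` and `δ` of `L`. -/
def mulMap (β : Fin n → L) (δ : Fin m → L) : Matrix (Fin n) (Fin m) F →ₗ[F] L where
  toFun N := ∑ i, ∑ j, N i j • (β i * δ j)
  map_add' M N := by simp only [Matrix.add_apply, add_smul, Finset.sum_add_distrib]
  map_smul' c N := by
    simp only [Matrix.smul_apply, smul_assoc, Finset.smul_sum, RingHom.id_apply]

theorem mulMap_apply (β : Fin n → L) (δ : Fin m → L) (N : Matrix (Fin n) (Fin m) F) :
    mulMap F β δ N = ∑ i, ∑ j, N i j • (β i * δ j) :=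
  rfl

theorem mulMap_vecMulVec (β : Fin n → L) (δ : Fin m → L) (v : Fin n → F) (w : Fin m → F) :
    mulMap F β δ (Matrix.vecMulVec v w) = (∑ i, v i • β i) * ∑ j, w j • δ j := by
  simp only [mulMap_apply, Matrix.vecMulVec_apply, Finset.sum_mul_sum, smul_mul_smul_comm]

theorem two_le_rank_of_mem_ker_mulMap {β : Fin n → L} {δ : Fin m → L}
    (hβ : LinearIndependent F β) (hδ : LinearIndependent F δ) {N : Matrix (Fin n) (Fin m) F}
    (hN : N ∈ LinearMap.ker (mulMap F β δ)) (hN₀ : N ≠ 0) : 2 ≤ N.rank := by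
  by_contra! hlt
  obtain ⟨v, w, rfl⟩ := MatrixCode.exists_eq_vecMulVec_of_rank_le_one (Nat.lt_succ_iff.1 hlt)
  rw [LinearMap.mem_ker, mulMap_vecMulVec, mul_eq_zero] at hN
  rcases hN with hv | hw
  · have hv₀ : v = 0 := funext (Fintype.linearIndependent_iff.1 hβ v hv)
    exact hN₀ (by ext; simp [hv₀, Matrix.vecMulVec_apply])
  · have hw₀ : w = 0 := funext (Fintype.linearIndependent_iff.1 hδ w hw)
    exact hN₀ (by ext; simp [hw₀, Matrix.vecMulVec_apply])

theorem mulMap_surjective {β : Fin n → L} (δ : Basis (Fin m) F L) {i : Fin n} (hi : β i ≠ 0) :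
    Function.Surjective (mulMap F β δ) := fun x =>
  ⟨Matrix.vecMulVec (Pi.single i 1) (δ.repr ((β i)⁻¹ * x)), by
    simp [mulMap_vecMulVec, Pi.single_apply, δ.sum_repr, hi]⟩

theorem finrank_ker_mulMap_add {β : Fin n → L} (δ : Basis (Fin m) F L) {i : Fin n}
    (hi : β i ≠ 0) : finrank F (LinearMap.ker (mulMap F β δ)) + m = n * m := by
  have hdim := (mulMap F β δ).finrank_range_add_finrank_ker
  rw [LinearMap.range_eq_top.2 (mulMap_surjective δ hi), finrank_top, finrank_eq_card_basis δ,
    finrank_matrix, finrank_self, mul_one, Fintype.card_fin, Fintype.card_fin] at hdim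
  rw [add_comm, hdim]

theorem trk_ker_mulMap_le {ι : Type*} [Fintype ι] {α : L} (hα : α ∉ Set.range (algebraMap F L))
    {t : ι → F} (hspan : Submodule.span F (Set.range fun k => (α - algebraMap F L (t k))⁻¹) = ⊤)
    (γ : Basis (Fin (n + 1)) F (powerSpan F (n + 1) α)) (δ : Basis (Fin m) F L) :
    MatrixCode.trk (LinearMap.ker (mulMap F (fun i => (γ i : L)) δ)) ≤ n * Fintype.card ι + 1 := by
  obtain ⟨ρ, hρ⟩ := LinearMap.exists_extend γ.equivFun.toLinearMap
  have hργ : ∀ i, ρ (γ i) = Pi.single i 1 := fun i =>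
    (LinearMap.congr_fun hρ (γ i)).trans (by simp [Finsupp.single_eq_pi_single])
  let ε : L →ₗ[F] L →ₗ[F] Matrix (Fin (n + 1)) (Fin m) F :=
    (vecMulVecBilin F F).compl₁₂ ρ δ.equivFun.toLinearMap
  let node := decompositionNode n α t
  let S := Submodule.span F (Set.range fun r => ε (node r) (node r)⁻¹)
  let τ : L →ₗ[F] L →ₗ[F] Matrix (Fin (n + 1)) (Fin m) F ⧸ S := ε.compr₂ S.mkQ
  have hτ : ∀ r, τ (node r) (node r)⁻¹ = 0 := fun r =>
    (Submodule.Quotient.mk_eq_zero S).2 (Submodule.subset_span ⟨r, rfl⟩)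
  have hker : LinearMap.ker (mulMap F (fun i => (γ i : L)) δ) ≤ S := by
    intro N hN
    have hsum : N = ∑ i, ∑ j, N i j • ε (γ i) (δ j) := by
      ext a b
      simp [Matrix.sum_apply, ε, hργ, Matrix.vecMulVec_apply, Pi.single_apply, Finsupp.single_apply]
    rw [← Submodule.Quotient.mk_eq_zero]
    calc S.mkQ N = ∑ i, ∑ j, N i j • τ (γ i) (δ j) := by
          conv_lhs => rw [hsum]
          simp only [map_sum, map_smul, τ, LinearMap.compr₂_apply]
      _ = τ 1 (mulMap F (fun i => (γ i : L)) δ N) := by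
          simp only [apply_eq_apply_one_mul τ hα hspan hτ (γ _).2, mulMap_apply, map_sum, map_smul]
      _ = 0 := by rw [LinearMap.mem_ker.1 hN, map_zero]
  refine (MatrixCode.trk_le_card_of_le_span (v := fun r => ρ (node r))
    (w := fun r => δ.equivFun (node r)⁻¹) hker).trans_eq ?_
  rw [Fintype.card_option, Fintype.card_prod, Fintype.card_fin]

theorem trk_ker_mulMap_eq_and_isMTR {α : L} (hα : α ∉ Set.range (algebraMap F L)) (hn : n ≠ 0)
    {t : Fin m → F} (hspan : Submodule.span F (Set.range fun k => (α - algebraMap F L (t k))⁻¹) = ⊤)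
    (γ : Basis (Fin (n + 1)) F (powerSpan F (n + 1) α)) (δ : Basis (Fin m) F L) :
    MatrixCode.trk (LinearMap.ker (mulMap F (fun i => (γ i : L)) δ)) = n * m + 1 ∧
      MatrixCode.IsMTR (LinearMap.ker (mulMap F (fun i => (γ i : L)) δ)) := by
  let V := LinearMap.ker (mulMap F (fun i => (γ i : L)) δ)
  have hγ : LinearIndependent F fun i => (γ i : L) :=
    γ.linearIndependent.map' _ (Submodule.ker_subtype _)
  have hdim : finrank F V = n * m := by
    have h : finrank F V + m = (n + 1) * m :=
      finrank_ker_mulMap_add (β := fun i => (γ i : L)) δ (hγ.ne_zero 0)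
    linarith [add_one_mul n m]
  have hm : m ≠ 0 := by
    rintro rfl
    exact one_ne_zero (δ.ext_elem_iff.2 fun i => i.elim0 : (1 : L) = 0)
  have hV : V ≠ ⊥ := Submodule.one_le_finrank_iff.1
    (hdim ▸ Nat.one_le_iff_ne_zero.2 (mul_ne_zero hn hm))
  have hupper : MatrixCode.trk V ≤ n * m + 1 := by
    simpa only [Fintype.card_fin] using trk_ker_mulMap_le hα hspan γ δ
  obtain ⟨htrk, hMTR⟩ := MatrixCode.trk_add_one_eq_and_isMTR hV
    (fun N => two_le_rank_of_mem_ker_mulMap hγ δ.linearIndependent) (by omega)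
  exact ⟨show MatrixCode.trk V = n * m + 1 by omega, hMTR⟩

theorem eq_zero_of_forall_apply_mul_eq_zero {l : Dual F L} (hl : l ≠ 0) {z : L}
    (h : ∀ x, l (x * z) = 0) : z = 0 := by
  by_contra hz
  exact hl (LinearMap.ext fun y => by simpa [hz] using h (y * z⁻¹))

theorem exists_basis_repr_eq_apply_mul (Γ : Basis (Fin m) F L) {l : Dual F L} (hl : l ≠ 0) :
    ∃ δ : Basis (Fin m) F L, ∀ y j, Γ.repr y j = l (y * δ j) := by
  have : FiniteDimensional F L := Γ.finiteDimensional_of_finite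
  let B : LinearMap.BilinForm F L := (LinearMap.mul F L).compr₂ l
  have hsymm : B.IsSymm := ⟨fun x y => by simp [B, mul_comm]⟩
  have hB : B.Nondegenerate :=
    ⟨fun z hz => eq_zero_of_forall_apply_mul_eq_zero hl fun x => by simpa [B, mul_comm] using hz x,
      fun _ hz => eq_zero_of_forall_apply_mul_eq_zero hl hz⟩
  refine ⟨B.dualBasis hB Γ, fun y j => ?_⟩
  conv_lhs => rw [← LinearMap.BilinForm.dualBasis_dualBasis hB hsymm Γ]
  exact LinearMap.BilinForm.dualBasis_repr_apply hB _ y j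

theorem dual_code_eq_ker_mulMap {s : ℕ} {U : Submodule F L} (γ : Basis (Fin n) F U)
    {Γ δ : Basis (Fin m) F L} {l : Dual F L} (hl : l ≠ 0)
    (hδ : ∀ y j, Γ.repr y j = l (y * δ j)) :
    MatrixCode.dual (code Γ γ 1 s 0) = LinearMap.ker (mulMap F (fun i => (γ i : L)) δ) := by
  have htrace : ∀ x N, (evalMap Γ (fun i => (γ i : L)) (C x * X) * N.transpose).trace =
      l (x * mulMap F (fun i => (γ i : L)) δ N) := by
    intro x N
    simp only [mulMap_apply, Finset.mul_sum, mul_smul_comm, map_sum, map_smul, smul_eq_mul,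
      Matrix.trace, Matrix.diag_apply, Matrix.mul_apply, Matrix.transpose_apply]
    refine Finset.sum_congr rfl fun i _ => Finset.sum_congr rfl fun j _ => ?_
    have hentry : evalMap Γ (fun i => (γ i : L)) (C x * X) i j = l (x * γ i * δ j) := by
      simp [evalMap, hδ]
    rw [hentry, mul_assoc, mul_comm]
  ext N
  constructor
  · intro hN
    refine eq_zero_of_forall_apply_mul_eq_zero hl fun x => ?_
    rw [← htrace]
    exact hN _ ⟨C x * X, mem_polys_one_zero_iff.2 ⟨x, rfl⟩, rfl⟩
  · rintro hN _ ⟨p, hp, rfl⟩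
    obtain ⟨x, rfl⟩ := mem_polys_one_zero_iff.1 hp
    exact (htrace x N).trans (by rw [LinearMap.mem_ker.1 hN, mul_zero, map_zero])

end Gabidulin

theorem mainTheorem2_general {F L : Type*} [Field F] [Field L] [Algebra F L]
    (n m s : ℕ) (hn : 2 ≤ n) (hq : (m : ℕ∞) ≤ ENat.card F)
    (α : L) (hα : IntermediateField.adjoin F {α} = ⊤)
    (Γ : Module.Basis (Fin m) F L)
    (γ : Module.Basis (Fin n) F (Gabidulin.powerSpan F n α)) :
    (MatrixCode.trk (MatrixCode.dual (Gabidulin.code Γ γ 1 s 0)) : ℤ) = m * n - m + 1 ∧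
      MatrixCode.IsMTR (MatrixCode.dual (Gabidulin.code Γ γ 1 s 0)) := by
  have : FiniteDimensional F L := Γ.finiteDimensional_of_finite
  have hm : Module.finrank F L = m := by
    rw [Module.finrank_eq_card_basis Γ, Fintype.card_fin]
  have hnm : n ≤ m := by
    simpa [hm, Module.finrank_eq_card_basis γ] using (Gabidulin.powerSpan F n α).finrank_le
  have hα' := Gabidulin.notMem_range_algebraMap_of_adjoin_eq_top hα (by omega)
  obtain ⟨t, -⟩ := Fin.Embedding.exists_embedding_disjoint_range_of_add_le_ENat_card
    (s := (∅ : Set F)) (n := m) (by simpa using hq)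
  have hspan := Gabidulin.span_inv_sub_eq_top hα t.injective (by simp [hm])
    fun k h => hα' ⟨t k, h.symm⟩
  obtain ⟨l, hl⟩ := exists_ne (0 : Module.Dual F L)
  obtain ⟨δ, hδ⟩ := Gabidulin.exists_basis_repr_eq_apply_mul Γ hl
  obtain ⟨k, rfl⟩ : ∃ k, n = k + 1 := ⟨n - 1, by omega⟩
  obtain ⟨htrk, hMTR⟩ := Gabidulin.trk_ker_mulMap_eq_and_isMTR hα' (by omega) hspan γ δ
  rw [Gabidulin.dual_code_eq_ker_mulMap γ hl hδ]
  refine ⟨?_, hMTR⟩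
  rw [htrk]
  push_cast
  ring

theorem mainTheorem2 {F L : Type*} [Field F] [Finite F] [Field L] [Algebra F L]
    (n m : ℕ) (hn : 2 ≤ n) (hnm : n ≤ m) (hq : m ≤ Nat.card F)
    (α : L) (hα : IntermediateField.adjoin F {α} = ⊤)
    (Γ : Module.Basis (Fin m) F L)
    (γ : Module.Basis (Fin n) F (Gabidulin.powerSpan F n α)) :
    (MatrixCode.trk (MatrixCode.dual (Gabidulin.code Γ γ 1 1 0)) : ℤ) = m * n - m + 1 ∧
      MatrixCode.IsMTR (MatrixCode.dual (Gabidulin.code Γ γ 1 1 0)) := by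
  have hcard : (m : ℕ∞) ≤ ENat.card F := by rw [ENat.card_eq_coe_natCard]; exact_mod_cast hq
  exact mainTheorem2_general n m 1 hn hcard α hα Γ γ
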